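/- For a nonempty finite word $v$ and $p\in\mathbb{N}$, let $v^{p/|v|}$ denote the prefix of length $p$ of the infinite word $vvv\cdots$. The (fractional) exponent of a nonempty finite word $u$ is $$\mathrm{E}(u)=\sup\{r\in\mathbb{Q} \mid u=v^{r}\text{ for some nonempty word } v\},$$ and the asymptotic critical exponent of an infinite word $w$ is $$\mathrm{ACE}(w)=\limsup_{n\to\infty}\,\sup\{\mathrm{E}(u)\mid u \text{ is a factor of } w \text{ of length } n\}.$$ For an infinite word $w=w_0w_1w_2\cdots$ over $\Sigma$ and a finite alphabet $\Gamma$ with at least two letters, let $$\mathrm{ACE}_{\mathcal I}(w)=\sup\{\mathrm{ACE}(h(w)) \mid h:\Sigma^*\to\Gamma^* \text{ an injective morphism}\},$$ where $h(w)=h(w_0)h(w_1)h(w_2)\cdots$. Corollary. There exists an infinite word $w$ over a two-letter alphabet such that $\mathrm{ACE}_{\mathcal I}(w)=1$ for every finite alphabet $\Gamma$ with at least two letters. -/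

import Mathlib

open scoped ENNReal

namespace Words

/-- The prefix of length `n` of the infinite word `w`. -/
def pref {α : Type*} (w : ℕ → α) (n : ℕ) : List α := (List.range n).map w

/-- The set of factors of length `n` of the infinite word `w`. -/
def factors {α : Type*} (n : ℕ) (w : ℕ → α) : Set (List α) :=
  {f | ∃ i : ℕ, f = pref (fun j => w (i + j)) n}

/-- The infinite word `v v v ⋯`, for a nonempty finite word `v`. -/
def omegaPow {α : Type*} (v : List α) (hv : v ≠ []) : ℕ → α :=
  fun i => v[i % v.length]'(Nat.mod_lt i (List.length_pos_of_ne_nil hv))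

/-- The fractional power of `v` with exponent `p / |v|`: the prefix of length `p` of `v v v ⋯`. -/
def fracPow {α : Type*} (v : List α) (hv : v ≠ []) (p : ℕ) : List α := pref (omegaPow v hv) p

/-- The fractional exponent of `u`: the supremum of the rationals `p / |v|` such that `u` is the
power of a nonempty word `v` with exponent `p / |v|`. -/
noncomputable def fracExp {α : Type*} (u : List α) : ℝ≥0∞ :=
  sSup {r | ∃ (v : List α) (hv : v ≠ []) (p : ℕ),
    u = fracPow v hv p ∧ r = (p : ℝ≥0∞) / (v.length : ℝ≥0∞)}

/-- The asymptotic critical exponent of an infinite word. -/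
noncomputable def ACE {α : Type*} (w : ℕ → α) : ℝ≥0∞ :=
  Filter.limsup (fun n : ℕ => ⨆ u ∈ factors n w, fracExp u) Filter.atTop

theorem length_le_of_injective {α β : Type*} (h : FreeMonoid α →* FreeMonoid β)
    (hh : Function.Injective h) (l : List α) :
    l.length ≤ (h (FreeMonoid.ofList l)).toList.length := by
  induction l with
  | nil => simp
  | cons a l ih =>
    have h1 : h (FreeMonoid.of a) ≠ 1 := fun e =>
      FreeMonoid.of_ne_one a (hh (e.trans (map_one h).symm))
    have h2 : 0 < (h (FreeMonoid.of a)).toList.length :=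
      List.length_pos_of_ne_nil fun e => h1 (FreeMonoid.toList.injective e)
    rw [FreeMonoid.ofList_cons, map_mul, FreeMonoid.toList_mul, List.length_append,
      List.length_cons]
    omega

/-- The image `h(w) = h(w₀) h(w₁) h(w₂) ⋯` of an infinite word `w` under an injective morphism `h`.
No letter is erased by `h`, so the letter at position `n` is found in `h(w₀ ⋯ wₙ)`. -/
def image {α β : Type*} (h : FreeMonoid α →* FreeMonoid β) (hh : Function.Injective h)
    (w : ℕ → α) : ℕ → β :=
  fun n => (h (FreeMonoid.ofList (pref w (n + 1)))).toList[n]'(by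
    have := length_le_of_injective h hh (pref w (n + 1))
    simp only [pref, List.length_map, List.length_range] at this ⊢
    omega)

/-- The mapped asymptotic critical exponent of an infinite word `w` over `α`: the supremum of the
asymptotic critical exponents of `h(w)` over all injective morphisms `h` from `α*` to `Γ*`. -/
noncomputable def mappedACE {α : Type*} (Γ : Type*) (w : ℕ → α) : ℝ≥0∞ :=
  ⨆ (h : FreeMonoid α →* FreeMonoid Γ) (hh : Function.Injective h), ACE (image h hh w)

end Words

/-!
The lower bound holds because every nonempty word has exponent at least `1` and some injective
morphism exists. For the upper bound, `w` is found by counting words that avoid the traces which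
long repetitions in `h(w)` would leave in `w`, for all injective morphisms `h` at once.

Let `h` be injective, so that `X = h(0)` and `Y = h(1)` do not commute. If `h(w)` has a long factor
of period `p` and exponent above `1 + 1/m`, then its repeated part has length `L > p / m`, and it
covers the images of about `L / max(|X|, |Y|)` letters of `w`. These letters are determined by the
prefix `v` of `w` before them and by `p`: the letters of the image are known one after the other
from the period, and they can be decoded because a product starting with `X` and one starting with
`Y` disagree within the first `|X| + |Y|` letters (`append_comm_of_common_prefix`,
`Continues.unique`).

Hence for a given `v` and a given length `k` there is at most one continuation to be avoided for
each morphism and each period. Enumerate the morphisms, of which there are countably many up to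
renaming letters, and forbid at length `k ≥ K` only the continuations for the first `k` morphisms
and for `p ≤ k ^ 2`. That leaves at most `k (k ^ 2 + 1)` forbidden continuations of length `k`.
Since `∑ k (k ^ 2 + 1) (2/3) ^ (k - 1)` converges, for large `K` the number of admissible binary
words of length `n` grows at least like `(3/2) ^ n` (`exists_forall_pref_not_bad`), and König's
lemma gives `w` (`exists_forall_not_continues`). For fixed `h` and `m`, a long repetition has period
linear in `k`, hence at most `k ^ 2`, and so it does not occur (`ACE_image_le_one`).
-/

namespace Words

/-! ### Two words that generate a free monoid -/

/-- If `Y = X Z`, a nonempty product of copies of `X` and `Y` is a product of copies of `X` and `Z`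
whose first factor is `X`. -/
theorem exists_flatMap_eq_append {β : Type*} {X Y Z : List β} (hY : Y = X ++ Z)
    (l : List (Fin 2)) (hl : l ≠ []) :
    ∃ l' : List (Fin 2), l.flatMap ![X, Y] = X ++ l'.flatMap ![X, Z] := by
  induction l with
  | nil => exact absurd rfl hl
  | cons a l ih =>
    have h : ∃ l' : List (Fin 2), l.flatMap ![X, Y] = l'.flatMap ![X, Z] := by
      by_cases hl' : l = []
      · exact ⟨[], by simp [hl']⟩
      · obtain ⟨l', h⟩ := ih hl'
        exact ⟨0 :: l', by simpa using h⟩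
    obtain ⟨l', h⟩ := h
    rw [List.flatMap_cons, h]
    fin_cases a
    · exact ⟨l', rfl⟩
    · exact ⟨1 :: l', by simp [hY]⟩

/-- A product of copies of `X` and `Y` that starts with the factor `X` and one that starts with the
factor `Y` can share a prefix of length `|X| + |Y|` only if `X` and `Y` commute. The proof is
Euclid's algorithm: if `Y = X Z`, then stripping one `X` from both products leaves products of
copies of `X` and `Z` with the same property. -/
theorem append_comm_of_common_prefix {β : Type*} (X Y : List β) (hX : X ≠ []) (hY : Y ≠ [])
    (s t : List (Fin 2)) (z : List β) (hz : z.length = X.length + Y.length)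
    (hs : z <+: X ++ s.flatMap ![X, Y]) (ht : z <+: Y ++ t.flatMap ![X, Y]) :
    X ++ Y = Y ++ X := by
  induction hn : X.length + Y.length using Nat.strong_induction_on generalizing X Y s t z with
  | _ n ih =>
  have swap : ∀ (A B : List β) (l : List (Fin 2)),
      l.flatMap ![A, B] = (l.map (Equiv.swap 0 1)).flatMap ![B, A] := by
    intro A B l
    rw [List.flatMap_map]
    congr 1
    funext a
    fin_cases a <;> simp
  wlog hle : X.length ≤ Y.length generalizing X Y s t
  · exact (this Y X hY hX (t.map (Equiv.swap 0 1)) (s.map (Equiv.swap 0 1)) (by omega)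
      (by rwa [← swap]) (by rwa [← swap]) (by omega) (by omega)).symm
  have hXz : X <+: z := List.prefix_of_prefix_length_le (List.prefix_append _ _) hs (by omega)
  have hYz : Y <+: z := List.prefix_of_prefix_length_le (List.prefix_append _ _) ht (by omega)
  obtain ⟨Z, rfl⟩ : X <+: Y := List.prefix_of_prefix_length_le hXz hYz hle
  by_cases hZ : Z = []
  · simp [hZ]
  obtain ⟨z, rfl⟩ := hXz
  rw [List.append_assoc, List.prefix_append_right_inj] at ht
  rw [List.prefix_append_right_inj] at hs
  have hX0 := List.length_pos_of_ne_nil hX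
  have hs0 : s ≠ [] := by
    rintro rfl
    have := hs.length_le
    simp only [List.length_append, List.flatMap_nil, List.length_nil] at hz this
    omega
  obtain ⟨s', hs'⟩ := exists_flatMap_eq_append (X := X) (Z := Z) rfl s hs0
  obtain ⟨t', ht'⟩ : ∃ t' : List (Fin 2),
      t.flatMap ![X, X ++ Z] = t'.flatMap ![X, Z] := by
    by_cases ht0 : t = []
    · exact ⟨[], by simp [ht0]⟩
    · obtain ⟨t', h⟩ := exists_flatMap_eq_append (X := X) (Z := Z) rfl t ht0
      exact ⟨0 :: t', by simpa using h⟩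
  rw [hs'] at hs
  rw [ht'] at ht
  simp only [List.length_append] at hz hn
  have := ih (X.length + Z.length) (by omega) X Z hX hZ s' t' z (by omega) hs ht rfl
  rw [List.append_assoc, ← this]

/-! ### Periodic continuations -/

/-- The word `φ(v)φ(x)`, prolonged by `|φ(0)| + |φ(1)|` letters of the image of some further word
`t`, continues `φ(v)` with period `p`. The prolongation is what makes `x` recoverable from `v`
and `p`. -/
def Continues {β : Type*} (φ : Fin 2 → List β) (p : ℕ) (v x : List (Fin 2)) : Prop :=
  1 ≤ p ∧ p ≤ (v.flatMap φ).length ∧ ∃ t : List (Fin 2),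
    ((v ++ x).flatMap φ).length + ((φ 0).length + (φ 1).length) ≤
      ((v ++ x ++ t).flatMap φ).length ∧
    ∀ q, (v.flatMap φ).length ≤ q →
      q < ((v ++ x).flatMap φ).length + ((φ 0).length + (φ 1).length) →
      ((v ++ x ++ t).flatMap φ)[q]? = ((v ++ x ++ t).flatMap φ)[q - p]?

theorem exists_first_difference {α : Type*} (x y : List α) (hlen : x.length = y.length)
    (hne : x ≠ y) : ∃ c a b r s, a ≠ b ∧ x = c ++ a :: r ∧ y = c ++ b :: s := by
  induction x generalizing y with
  | nil => exact absurd (List.length_eq_zero_iff.1 hlen.symm).symm hne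
  | cons a x ih =>
    obtain _ | ⟨b, y⟩ := y
    · simp at hlen
    by_cases hab : a = b
    · subst hab
      obtain ⟨c, a', b', r, s, h1, h2, h3⟩ := ih y (by simpa using hlen) (by simpa using hne)
      exact ⟨a :: c, a', b', r, s, h1, by simp [h2], by simp [h3]⟩
    · exact ⟨[], a, b, x, y, hab, rfl, rfl⟩

/-- Two words that have the same letters before position `b` and satisfy the same recurrence
`W[q] = W[q - p]` from there up to position `e` have the same letters before `e`. -/
theorem getElem?_eq_of_periodic {β : Type*} {W W' : List β} {p b e : ℕ} (hp : 1 ≤ p) (hb : p ≤ b)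
    (h0 : ∀ q < b, W[q]? = W'[q]?)
    (hW : ∀ q, b ≤ q → q < e → W[q]? = W[q - p]?)
    (hW' : ∀ q, b ≤ q → q < e → W'[q]? = W'[q - p]?) (q : ℕ) (hq : q < e) :
    W[q]? = W'[q]? := by
  induction q using Nat.strong_induction_on with
  | _ q ih =>
    rcases lt_or_ge q b with h | h
    · exact h0 q h
    · rw [hW q h hq, hW' q h hq]
      exact ih _ (by omega) (by omega)

/-- If `φ(0)` and `φ(1)` do not commute, then `v`, the period and the length determine a
continuation: where two of them first differ, the prolonged images still agree for
`|φ(0)| + |φ(1)|` letters, which `append_comm_of_common_prefix` excludes. -/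
theorem Continues.unique {β : Type*} {φ : Fin 2 → List β} (hφ : φ 0 ++ φ 1 ≠ φ 1 ++ φ 0) {p : ℕ}
    {v x y : List (Fin 2)} (hx : Continues φ p v x) (hy : Continues φ p v y)
    (hlen : x.length = y.length) : x = y := by
  by_contra hne
  obtain ⟨hp, hpv, t, ht, hxt⟩ := hx
  obtain ⟨-, -, t', ht', hyt⟩ := hy
  obtain ⟨c, a, b, r, s, hab, rfl, rfl⟩ := exists_first_difference x y hlen hne
  simp only [List.append_assoc, List.cons_append, List.flatMap_append, List.flatMap_cons,
    List.length_append] at ht ht' hxt hyt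
  set V := v.flatMap φ
  set C := c.flatMap φ
  have key := getElem?_eq_of_periodic (e := V.length + C.length + ((φ 0).length + (φ 1).length))
    hp hpv (fun q hq => by rw [List.getElem?_append_left hq, List.getElem?_append_left hq])
    (fun q h1 h2 => hxt q h1 (by omega)) (fun q h1 h2 => hyt q h1 (by omega))
  -- Past the common prefix, the two images start with `φ a` and `φ b`.
  have key' : ∀ q < (φ 0).length + (φ 1).length,
      (φ a ++ (r ++ t).flatMap φ)[q]? = (φ b ++ (s ++ t').flatMap φ)[q]? := by
    intro q hq
    have hshift : ∀ W : List β, (V ++ (C ++ W))[V.length + (C.length + q)]? = W[q]? := by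
      intro W
      rw [List.getElem?_append_right (Nat.le_add_right _ _), Nat.add_sub_cancel_left,
        List.getElem?_append_right (Nat.le_add_right _ _), Nat.add_sub_cancel_left]
    have := key (V.length + (C.length + q)) (by omega)
    rw [hshift, hshift] at this
    simpa using this
  have h0 : φ 0 ≠ [] := fun h => hφ (by simp [h])
  have h1 : φ 1 ≠ [] := fun h => hφ (by simp [h])
  have hvec : φ = ![φ 0, φ 1] := by
    funext i
    fin_cases i <;> rfl
  have hpre : ∀ W W' : List β, (φ 0).length + (φ 1).length ≤ W.length →
      (∀ q < (φ 0).length + (φ 1).length, W[q]? = W'[q]?) →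
      W.take ((φ 0).length + (φ 1).length) <+: W' := by
    intro W W' _ h
    have : W.take ((φ 0).length + (φ 1).length) = W'.take ((φ 0).length + (φ 1).length) := by
      apply List.ext_getElem?
      intro q
      rw [List.getElem?_take, List.getElem?_take]
      split_ifs with hq
      · exact h q hq
      · rfl
    rw [this]
    exact List.take_prefix _ _
  have hla : (φ 0).length + (φ 1).length ≤ (φ a ++ (r ++ t).flatMap φ).length := by
    simp only [List.flatMap_append, List.length_append]
    omega
  have hlb : (φ 0).length + (φ 1).length ≤ (φ b ++ (s ++ t').flatMap φ).length := by
    simp only [List.flatMap_append, List.length_append]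
    omega
  have hcases : (a = 0 ∧ b = 1) ∨ (a = 1 ∧ b = 0) :=
    (by decide : ∀ a b : Fin 2, a ≠ b → (a = 0 ∧ b = 1) ∨ (a = 1 ∧ b = 0)) a b hab
  apply hφ
  rcases hcases with ⟨rfl, rfl⟩ | ⟨rfl, rfl⟩
  · refine append_comm_of_common_prefix _ _ h0 h1 (r ++ t) (s ++ t') _ (List.length_take_of_le hla)
      ?_ ?_ <;> rw [← hvec]
    · exact List.take_prefix _ _
    · exact hpre _ _ hla key'
  · refine append_comm_of_common_prefix _ _ h0 h1 (s ++ t') (r ++ t) _ (List.length_take_of_le hlb)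
      ?_ ?_ <;> rw [← hvec]
    · exact List.take_prefix _ _
    · exact hpre _ _ hlb fun q hq => (key' q hq).symm

/-! ### Counting words that avoid rare continuations -/

@[simp] theorem length_pref {α : Type*} (w : ℕ → α) (n : ℕ) : (pref w n).length = n := by
  simp [pref]

theorem getElem_pref {α : Type*} (w : ℕ → α) (n i : ℕ) (h : i < (pref w n).length) :
    (pref w n)[i] = w i := by
  simp [pref]

/-- König's lemma for binary words: a prefix-closed property satisfied by words of every length
is satisfied by all prefixes of some infinite word. -/
theorem exists_forall_pref (P : List (Fin 2) → Prop) (hP : ∀ u v, u <+: v → P v → P u)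
    (hne : ∀ n, ∃ u, u.length = n ∧ P u) : ∃ w : ℕ → Fin 2, ∀ n, P (pref w n) := by
  let A : ℕ → Type := fun n => {u : List (Fin 2) // u.length = n ∧ P u}
  have hfin : ∀ n, Finite (A n) := fun n =>
    Set.Finite.subset (List.finite_length_eq (Fin 2) n) fun u hu => hu.1
  have : ∀ n, Nonempty (A n) := fun n => let ⟨u, hu⟩ := hne n; ⟨⟨u, hu⟩⟩
  let π : {i j : ℕ} → i ≤ j → A j → A i := fun {i j} hij u =>
    ⟨u.1.take i, List.length_take_of_le (hij.trans_eq u.2.1.symm),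
      hP _ _ (List.take_prefix _ _) u.2.2⟩
  obtain ⟨f, hf⟩ := exists_seq_forall_proj_of_forall_finite π
    (fun i a => Subtype.ext (List.take_of_length_le a.2.1.le))
    (fun i j k hij hjk a => Subtype.ext (by simp [π, List.take_take, hij]))
    (fun i a => Set.toFinite _)
  refine ⟨fun n => (f (n + 1)).1[n]'(by rw [(f (n + 1)).2.1]; omega), fun n => ?_⟩
  convert (f n).2.2
  refine List.ext_getElem (by rw [length_pref, (f n).2.1]) fun i h1 h2 => ?_
  rw [length_pref] at h1
  have h := congrArg Subtype.val (hf (Nat.succ_le_of_lt h1))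
  have h' : (f (i + 1)).1[i]? = (f n).1[i]? := by
    rw [← h, List.getElem?_take_of_lt (Nat.lt_succ_self i)]
  rw [List.getElem?_eq_getElem h2, List.getElem?_eq_getElem (by rw [(f (i + 1)).2.1]; omega)] at h'
  rw [getElem_pref]
  exact Option.some_injective _ h'

/-- The binary words of length `n` no nonempty prefix of which ends in a bad continuation; `Bad k u`
is meant to say that the last `k` letters of `u` continue the rest of `u` badly. -/
noncomputable def goodWords (Bad : ℕ → List (Fin 2) → Prop) : ℕ → Finset (List (Fin 2))
  | 0 => {[]}
  | n + 1 => by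
    classical
    exact Finset.filter (fun u => ∀ k, 1 ≤ k → k ≤ n + 1 → ¬ Bad k u)
      ((goodWords Bad n ×ˢ Finset.univ).image fun x => x.1 ++ [x.2])

theorem mem_goodWords_succ {Bad : ℕ → List (Fin 2) → Prop} {n : ℕ} {u : List (Fin 2)} :
    u ∈ goodWords Bad (n + 1) ↔ (∃ v ∈ goodWords Bad n, ∃ a, v ++ [a] = u) ∧
      ∀ k, 1 ≤ k → k ≤ n + 1 → ¬ Bad k u := by
  simp only [goodWords, Finset.mem_filter, Finset.mem_image, Finset.mem_product, Finset.mem_univ,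
    and_true, Prod.exists, exists_and_left]

theorem length_of_mem_goodWords {Bad : ℕ → List (Fin 2) → Prop} {n : ℕ} {u : List (Fin 2)}
    (hu : u ∈ goodWords Bad n) : u.length = n := by
  induction n generalizing u with
  | zero => simpa [goodWords] using hu
  | succ n ih =>
    obtain ⟨⟨v, hv, a, rfl⟩, -⟩ := mem_goodWords_succ.1 hu
    simp [ih hv]

theorem take_mem_goodWords {Bad : ℕ → List (Fin 2) → Prop} {n m : ℕ} {u : List (Fin 2)}
    (hu : u ∈ goodWords Bad n) (hm : m ≤ n) : u.take m ∈ goodWords Bad m := by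
  induction n generalizing u with
  | zero =>
    obtain rfl : m = 0 := by omega
    simp [goodWords]
  | succ n ih =>
    rcases hm.eq_or_lt with rfl | hm
    · rwa [List.take_of_length_le (length_of_mem_goodWords hu).le]
    · obtain ⟨⟨v, hv, a, rfl⟩, -⟩ := mem_goodWords_succ.1 hu
      rw [List.take_append_of_le_length (by rw [length_of_mem_goodWords hv]; omega)]
      exact ih hv (by omega)

/-- One step of the count: of the `2 |G n|` one-letter extensions of good words of length `n`, at
most `b k * |G (n + 1 - k)|` are lost to bad continuations of length `k`. -/
theorem two_mul_card_goodWords_le {Bad : ℕ → List (Fin 2) → Prop} {b : ℕ → ℕ}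
    (S : ℕ → List (Fin 2) → Finset (List (Fin 2))) (hS : ∀ k v, (S k v).card ≤ b k)
    (hbad : ∀ k v x, x.length = k → Bad k (v ++ x) → x ∈ S k v) (n : ℕ) :
    2 * (goodWords Bad n).card ≤ (goodWords Bad (n + 1)).card +
      ∑ k ∈ Finset.Icc 1 (n + 1), b k * (goodWords Bad (n + 1 - k)).card := by
  classical
  set G := goodWords Bad
  set E := (G n ×ˢ (Finset.univ : Finset (Fin 2))).image fun x => x.1 ++ [x.2]
  have hE : E.card = 2 * (G n).card := by
    rw [Finset.card_image_of_injective, Finset.card_product, Finset.card_univ, Fintype.card_fin,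
      mul_comm]
    rintro ⟨v, a⟩ ⟨v', a'⟩ h
    simpa using List.append_inj' h rfl
  have hsub : E ⊆ G (n + 1) ∪ (Finset.Icc 1 (n + 1)).biUnion fun k =>
      (G (n + 1 - k)).biUnion fun v => (S k v).image (v ++ ·) := by
    intro u hu
    by_cases hg : u ∈ G (n + 1)
    · exact Finset.mem_union_left _ hg
    apply Finset.mem_union_right
    obtain ⟨v, hv, a, rfl⟩ : ∃ v ∈ G n, ∃ a, v ++ [a] = u := by simpa [E] using hu
    have hlen := length_of_mem_goodWords hv
    obtain ⟨k, h1, hk, hB⟩ : ∃ k, 1 ≤ k ∧ k ≤ n + 1 ∧ Bad k (v ++ [a]) := by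
      by_contra! h
      exact hg (mem_goodWords_succ.2 ⟨⟨v, hv, a, rfl⟩, h⟩)
    simp only [Finset.mem_biUnion, Finset.mem_Icc, Finset.mem_image]
    have htake : (v ++ [a]).take (n + 1 - k) = v.take (n + 1 - k) :=
      List.take_append_of_le_length (by omega)
    refine ⟨k, ⟨h1, hk⟩, (v ++ [a]).take (n + 1 - k), ?_, (v ++ [a]).drop (n + 1 - k), ?_,
      List.take_append_drop _ _⟩
    · rw [htake]
      exact take_mem_goodWords hv (by omega)
    · apply hbad
      · simp only [List.length_drop, List.length_append, hlen, List.length_singleton]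
        omega
      · rwa [List.take_append_drop]
  rw [← hE]
  refine (Finset.card_le_card hsub).trans ((Finset.card_union_le _ _).trans ?_)
  gcongr
  refine Finset.card_biUnion_le.trans (Finset.sum_le_sum fun k _ => ?_)
  refine Finset.card_biUnion_le.trans ?_
  rw [mul_comm]
  exact Finset.sum_le_card_nsmul _ _ _ fun v _ => Finset.card_image_le.trans (hS k v)

/-- If every word `v` has at most `b k` bad continuations of length `k`, and
`∑ b k (2/3)^(k-1) ≤ 1/2`, then some infinite word has no bad prefix: the number of good words grows
at least by the factor `3/2` at each step. -/
theorem exists_forall_pref_not_bad {Bad : ℕ → List (Fin 2) → Prop} {b : ℕ → ℕ}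
    (S : ℕ → List (Fin 2) → Finset (List (Fin 2))) (hS : ∀ k v, (S k v).card ≤ b k)
    (hbad : ∀ k v x, x.length = k → Bad k (v ++ x) → x ∈ S k v)
    (hsum : ∀ n, ∑ k ∈ Finset.Icc 1 n, (b k : ℝ) * (2 / 3) ^ (k - 1) ≤ 1 / 2) :
    ∃ w : ℕ → Fin 2, ∀ n k, 1 ≤ k → k ≤ n → ¬ Bad k (pref w n) := by
  have hgrow : ∀ n, (3 / 2 : ℝ) * (goodWords Bad n).card ≤ (goodWords Bad (n + 1)).card := by
    intro n
    induction n using Nat.strong_induction_on with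
    | _ n ih =>
    -- Going back `i` steps divides the count by at least `(3/2)^i`.
    have hback : ∀ i ≤ n, ((goodWords Bad (n - i)).card : ℝ) ≤
        (2 / 3) ^ i * (goodWords Bad n).card := by
      intro i
      induction i with
      | zero => simp
      | succ i hi =>
        intro hin
        have h1 := hi (by omega)
        have h2 := ih (n - (i + 1)) (by omega)
        rw [show n - (i + 1) + 1 = n - i by omega] at h2
        rw [pow_succ]
        linarith
    have h := two_mul_card_goodWords_le S hS hbad n
    have h' : (2 : ℝ) * (goodWords Bad n).card ≤ (goodWords Bad (n + 1)).card +
        ∑ k ∈ Finset.Icc 1 (n + 1), b k * ((goodWords Bad (n + 1 - k)).card : ℝ) := by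
      exact_mod_cast h
    have hle : ∑ k ∈ Finset.Icc 1 (n + 1), b k * ((goodWords Bad (n + 1 - k)).card : ℝ) ≤
        (∑ k ∈ Finset.Icc 1 (n + 1), (b k : ℝ) * (2 / 3) ^ (k - 1)) * (goodWords Bad n).card := by
      rw [Finset.sum_mul]
      refine Finset.sum_le_sum fun k hk => ?_
      rw [Finset.mem_Icc] at hk
      rw [mul_assoc]
      have := hback (k - 1) (by omega)
      rw [show n - (k - 1) = n + 1 - k by omega] at this
      gcongr
    have := mul_le_mul_of_nonneg_right (hsum (n + 1)) (Nat.cast_nonneg (α := ℝ)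
      (goodWords Bad n).card)
    linarith
  have hpos : ∀ n, 0 < (goodWords Bad n).card := by
    intro n
    induction n with
    | zero => simp [goodWords]
    | succ n ih =>
      have h := hgrow n
      have : (0 : ℝ) < (goodWords Bad n).card := by exact_mod_cast ih
      exact_mod_cast (by positivity : (0 : ℝ) < 3 / 2 * (goodWords Bad n).card).trans_le h
  obtain ⟨w, hw⟩ := exists_forall_pref (fun u => u ∈ goodWords Bad u.length)
    (fun u v huv hv => by
      have := take_mem_goodWords hv huv.length_le
      rwa [← List.prefix_iff_eq_take.1 huv] at this)
    (fun n => by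
      obtain ⟨u, hu⟩ := Finset.card_pos.1 (hpos n)
      have := length_of_mem_goodWords hu
      exact ⟨u, this, by rwa [this]⟩)
  refine ⟨w, fun n k h1 hk => ?_⟩
  obtain ⟨n, rfl⟩ : ∃ m, n = m + 1 := ⟨n - 1, by omega⟩
  have h := hw (n + 1)
  rw [length_pref] at h
  exact (mem_goodWords_succ.1 h).2 k h1 hk

/-- There are a binary word `w` and a threshold `K` such that no prefix of `w` ends in a periodic
continuation of any length `k ≥ K`, for the first `k` morphisms of a given sequence and periods
up to `k ^ 2`. -/
theorem exists_forall_not_continues {β : Type*} (φ : ℕ → Fin 2 → List β) :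
    ∃ (w : ℕ → Fin 2) (K : ℕ), ∀ s k j p, K ≤ k → j < k → p ≤ k ^ 2 →
      φ j 0 ++ φ j 1 ≠ φ j 1 ++ φ j 0 →
      ¬ Continues (φ j) p (pref w s) ((pref w (s + k)).drop s) := by
  classical
  obtain ⟨K, hK1, hK⟩ : ∃ K, 1 ≤ K ∧ ∀ n, ∑ k ∈ Finset.Icc 1 n,
      ((if K ≤ k then k * (k ^ 2 + 1) else 0 : ℕ) : ℝ) * (2 / 3) ^ (k - 1) ≤ 1 / 2 := by
    set f : ℕ → ℝ := fun k => (k * (k ^ 2 + 1) : ℕ) * (2 / 3) ^ (k - 1)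
    have hf0 : ∀ k, 0 ≤ f k := fun k => by positivity
    have hf : Summable f := by
      have h3 := summable_pow_mul_geometric_of_norm_lt_one (R := ℝ) 3 (r := 2 / 3)
        (by rw [Real.norm_eq_abs, abs_of_pos] <;> norm_num)
      have h1 := summable_pow_mul_geometric_of_norm_lt_one (R := ℝ) 1 (r := 2 / 3)
        (by rw [Real.norm_eq_abs, abs_of_pos] <;> norm_num)
      refine ((h3.add h1).mul_left (3 / 2)).congr fun k => ?_
      obtain _ | k := k
      · simp [f]
      · simp only [f, Nat.add_sub_cancel]
        push_cast
        ring
    have hev := (tendsto_sum_nat_add f).eventually (ge_mem_nhds (by norm_num : (0 : ℝ) < 1 / 2))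
    obtain ⟨K, hK1, hK⟩ := ((Filter.eventually_ge_atTop 1).and hev).exists
    refine ⟨K, hK1, fun n => le_trans ?_ hK⟩
    calc _ = ∑ k ∈ (Finset.Icc 1 n).filter (K ≤ ·), f k := by
          rw [Finset.sum_filter]
          refine Finset.sum_congr rfl fun k _ => ?_
          split_ifs <;> simp [f]
      _ ≤ ∑ k ∈ (Finset.range (n + 1)).image (· + K), f k := by
          refine Finset.sum_le_sum_of_subset_of_nonneg (fun k hk => ?_) fun k _ _ => hf0 k
          simp only [Finset.mem_filter, Finset.mem_Icc] at hk
          exact Finset.mem_image.2 ⟨k - K, Finset.mem_range.2 (by omega), by omega⟩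
      _ = ∑ k ∈ Finset.range (n + 1), f (k + K) :=
          Finset.sum_image fun a _ b _ h => Nat.add_right_cancel h
      _ ≤ _ := ((summable_nat_add_iff K).2 hf).sum_le_tsum _ fun k _ => hf0 _
  let C : ℕ → ℕ → ℕ → List (Fin 2) → List (Fin 2) → Prop := fun k j p v x =>
    φ j 0 ++ φ j 1 ≠ φ j 1 ++ φ j 0 ∧ Continues (φ j) p v x ∧ x.length = k
  -- By `Continues.unique` this choice lists all the continuations in question.
  let S : ℕ → List (Fin 2) → Finset (List (Fin 2)) := fun k v =>
    if K ≤ k then (Finset.range k ×ˢ Finset.range (k ^ 2 + 1)).image fun jp =>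
      Classical.epsilon (C k jp.1 jp.2 v) else ∅
  let Bad : ℕ → List (Fin 2) → Prop := fun k u =>
    K ≤ k ∧ ∃ j < k, ∃ p ≤ k ^ 2, C k j p (u.take (u.length - k)) (u.drop (u.length - k))
  obtain ⟨w, hw⟩ := exists_forall_pref_not_bad (Bad := Bad)
    (b := fun k => if K ≤ k then k * (k ^ 2 + 1) else 0) S
    (fun k v => by
      by_cases h : K ≤ k
      · simp only [S, if_pos h]
        exact Finset.card_image_le.trans (by simp)
      · simp [S, h])
    (fun k v x hx hB => by
      obtain ⟨hk, j, hj, p, hp, hC⟩ := hB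
      simp only [List.length_append, hx, Nat.add_sub_cancel, List.take_left, List.drop_left] at hC
      simp only [S, if_pos hk, Finset.mem_image]
      refine ⟨(j, p), by simp; omega, ?_⟩
      have he : C k j p v (Classical.epsilon (C k j p v)) := Classical.epsilon_spec ⟨x, hC⟩
      exact he.2.1.unique hC.1 hC.2.1 (he.2.2.trans hC.2.2.symm))
    hK
  refine ⟨w, K, fun s k j p hk hj hp hne hc => ?_⟩
  refine hw (s + k) k (by omega) (by omega) ⟨hk, j, hj, p, hp, hne, ?_, ?_⟩
  · rw [length_pref, Nat.add_sub_cancel]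
    convert hc
    simp [pref, ← List.map_take, List.take_range]
  · simp

/-! ### Repetitions in morphic images -/

theorem toList_map_ofList {α β : Type*} (h : FreeMonoid α →* FreeMonoid β) (l : List α) :
    (h (FreeMonoid.ofList l)).toList = l.flatMap fun a => (h (FreeMonoid.of a)).toList := by
  induction l with
  | nil => simp
  | cons a l ih => rw [FreeMonoid.ofList_cons, map_mul, FreeMonoid.toList_mul, ih,
      List.flatMap_cons]

theorem pref_add {α : Type*} (w : ℕ → α) (m n : ℕ) :
    pref w (m + n) = pref w m ++ pref (fun j => w (m + j)) n := by
  simp [pref, List.range_add]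

theorem pref_prefix {α : Type*} (w : ℕ → α) {m n : ℕ} (h : m ≤ n) : pref w m <+: pref w n := by
  obtain ⟨d, rfl⟩ := Nat.exists_eq_add_of_le h
  exact ⟨_, (pref_add w m d).symm⟩

theorem drop_pref_add {α : Type*} (w : ℕ → α) (m n : ℕ) :
    (pref w (m + n)).drop m = pref (fun j => w (m + j)) n := by
  rw [pref_add, List.drop_left' (length_pref w m)]

theorem flatMap_prefix_flatMap {α β : Type*} (φ : α → List β) {u v : List α} (h : u <+: v) :
    u.flatMap φ <+: v.flatMap φ := by
  obtain ⟨t, rfl⟩ := h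
  exact ⟨t.flatMap φ, List.flatMap_append.symm⟩

theorem length_le_length_flatMap {α β : Type*} {φ : α → List β} (hφ : ∀ a, φ a ≠ [])
    (l : List α) : l.length ≤ (l.flatMap φ).length := by
  induction l with
  | nil => simp
  | cons a l ih =>
    have := List.length_pos_of_ne_nil (hφ a)
    simp only [List.length_cons, List.flatMap_cons, List.length_append]
    omega

theorem length_flatMap_le {α β : Type*} {φ : α → List β} {M : ℕ} (hφ : ∀ a, (φ a).length ≤ M)
    (l : List α) : (l.flatMap φ).length ≤ l.length * M := by
  induction l with
  | nil => simp
  | cons a l ih =>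
    have := hφ a
    simp only [List.length_cons, List.flatMap_cons, List.length_append, add_mul]
    omega

/-- The letters of `h(w)`, renamed by `f`, can be read off in the image of any sufficiently long
prefix of `w`. -/
theorem getElem?_flatMap_pref {α β γ : Type*} (h : FreeMonoid α →* FreeMonoid β)
    (hh : Function.Injective h) (f : β → γ) (w : ℕ → α) {n q : ℕ}
    (hq : q < ((pref w n).flatMap fun a => (h (FreeMonoid.of a)).toList.map f).length) :
    ((pref w n).flatMap fun a => (h (FreeMonoid.of a)).toList.map f)[q]? =
      some (f (image h hh w q)) := by
  have hmap : ∀ l : List α, (l.flatMap fun a => (h (FreeMonoid.of a)).toList.map f) =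
      (h (FreeMonoid.ofList l)).toList.map f := by
    intro l
    rw [toList_map_ofList, List.map_flatMap]
  rw [hmap, List.length_map] at hq
  have hq' : q < (h (FreeMonoid.ofList (pref w (q + 1)))).toList.length := by
    have := length_le_of_injective h hh (pref w (q + 1))
    rw [length_pref] at this
    omega
  have key : ∀ m, m ≤ max n (q + 1) → q < (h (FreeMonoid.ofList (pref w m))).toList.length →
      (h (FreeMonoid.ofList (pref w m))).toList[q]? =
        (h (FreeMonoid.ofList (pref w (max n (q + 1))))).toList[q]? := by
    intro m hm hqm
    obtain ⟨r, hr⟩ := flatMap_prefix_flatMap (fun a => (h (FreeMonoid.of a)).toList)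
      (pref_prefix w hm)
    rw [← toList_map_ofList, ← toList_map_ofList] at hr
    rw [← hr, List.getElem?_append_left hqm]
  rw [hmap, List.getElem?_map, key n (le_max_left _ _) hq, ← key (q + 1) (le_max_right _ _) hq',
    List.getElem?_eq_getElem hq']
  rfl

/-- A repetition of period `p` at position `i` of `φ(w)` whose repeated part has length at least
`(k + 4) M`, where `M` bounds the lengths of `φ(0)` and `φ(1)`, makes `k` letters of `w` a
continuation of period `p`. Here `g` is the infinite word `φ(w)`. -/
theorem exists_continues_of_repetition {β : Type*} {φ : Fin 2 → List β} (hφ : ∀ a, φ a ≠ [])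
    {M : ℕ} (hM : ∀ a, (φ a).length ≤ M) {w : ℕ → Fin 2} {g : ℕ → β}
    (hg : ∀ n q, q < ((pref w n).flatMap φ).length → ((pref w n).flatMap φ)[q]? = some (g q))
    {i p k L : ℕ} (hp : 1 ≤ p) (hL : (k + 3) * M ≤ L)
    (hrep : ∀ t < L, g (i + t) = g (i + p + t)) :
    ∃ s, Continues φ p (pref w s) ((pref w (s + k)).drop s) := by
  have hex : ∃ s, i + p ≤ ((pref w s).flatMap φ).length :=
    ⟨i + p, by simpa using length_le_length_flatMap hφ (pref w (i + p))⟩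
  classical
  obtain ⟨s, hs, hmin⟩ : ∃ s, i + p ≤ ((pref w s).flatMap φ).length ∧
      ((pref w s).flatMap φ).length ≤ i + p + M := by
    refine ⟨Nat.find hex, Nat.find_spec hex, ?_⟩
    rcases hz : Nat.find hex with _ | m
    · simp [pref]
    · have h1 := Nat.find_min hex (m := m) (by omega)
      rw [pref_add, List.flatMap_append, List.length_append]
      have h2 := length_flatMap_le hM (pref (fun j => w (m + j)) 1)
      rw [length_pref, one_mul] at h2
      omega
  have hk : ((pref w (s + k)).flatMap φ).length ≤ ((pref w s).flatMap φ).length + k * M := by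
    rw [pref_add, List.flatMap_append, List.length_append]
    have := length_flatMap_le hM (pref (fun j => w (s + j)) k)
    rw [length_pref] at this
    omega
  set D := (φ 0).length + (φ 1).length with hD
  refine ⟨s, hp, by omega, (pref w (s + k + D)).drop (s + k), ?_⟩
  have h1 : pref w s ++ (pref w (s + k)).drop s = pref w (s + k) := by
    rw [drop_pref_add, pref_add]
  rw [h1, drop_pref_add, ← pref_add, ← hD]
  have hlen : ((pref w (s + k)).flatMap φ).length + D ≤
      ((pref w (s + k + D)).flatMap φ).length := by
    rw [pref_add w (s + k), List.flatMap_append, List.length_append]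
    have := length_le_length_flatMap hφ (pref (fun j => w (s + k + j)) D)
    rw [length_pref] at this
    omega
  refine ⟨hlen, fun q hq1 hq2 => ?_⟩
  rw [hg _ q (by omega), hg _ (q - p) (by omega)]
  have hDM : D ≤ 2 * M := by
    have := hM 0
    have := hM 1
    omega
  have := hrep (q - p - i) (by rw [add_mul] at hL; omega)
  rw [show i + (q - p - i) = q - p by omega, show i + p + (q - p - i) = q by omega] at this
  rw [this]

/-! ### The asymptotic critical exponent -/

theorem length_fracPow {α : Type*} (v : List α) (hv : v ≠ []) (p : ℕ) :
    (fracPow v hv p).length = p := length_pref _ _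

theorem one_le_fracExp {α : Type*} {u : List α} (hu : u ≠ []) : 1 ≤ fracExp u := by
  refine le_sSup ⟨u, hu, u.length, ?_, ?_⟩
  · refine List.ext_getElem (length_fracPow _ _ _).symm fun i h1 h2 => ?_
    simp [fracPow, pref, omegaPow, Nat.mod_eq_of_lt h1]
  · rw [ENNReal.div_self] <;> simp [hu]

theorem one_le_ACE {α : Type*} (w : ℕ → α) : 1 ≤ ACE w := by
  refine Filter.le_limsup_of_frequently_le' (Filter.Eventually.frequently ?_)
  filter_upwards [Filter.eventually_ge_atTop 1] with n hn
  have hne : pref (fun j => w (0 + j)) n ≠ [] := by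
    rw [← List.length_pos_iff, length_pref]
    exact hn
  exact (one_le_fracExp hne).trans (le_iSup₂_of_le _ ⟨0, rfl⟩ le_rfl)

/-- To bound the asymptotic critical exponent by `1` it suffices to show, for each `m`, that long
factors of length `n` have no period `p` with `n - p > p / m`. -/
theorem ACE_le_one {α : Type*} {g : ℕ → α}
    (h : ∀ m : ℕ, ∃ N, ∀ i p L, 1 ≤ p → N ≤ L → p < m * L →
      ¬ ∀ t < L, g (i + t) = g (i + p + t)) : ACE g ≤ 1 := by
  refine le_of_forall_gt_imp_ge_of_dense fun c hc => ?_
  obtain ⟨m, hm⟩ := ENNReal.exists_inv_nat_lt (tsub_pos_of_lt hc).ne'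
  have hmc : 1 + (m : ℝ≥0∞)⁻¹ ≤ c := by
    rw [← add_tsub_cancel_of_le hc.le]
    gcongr
  have hm0 : m ≠ 0 := by
    rintro rfl
    simp at hm
  refine le_trans ?_ hmc
  obtain ⟨N, hN⟩ := h m
  refine Filter.limsup_le_of_le (by isBoundedDefault) ?_
  filter_upwards [Filter.eventually_ge_atTop ((m + 1) * N)] with n hn
  refine iSup₂_le fun u ⟨i, hu⟩ => sSup_le ?_
  rintro r ⟨v, hv, p, hp, rfl⟩
  obtain rfl : p = n := by
    rw [← length_fracPow v hv p, ← hp, hu, length_pref]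
  by_contra hlt
  have hv0 := List.length_pos_of_ne_nil hv
  have hlt' : (m + 1) * v.length < m * p := by
    by_contra! hle
    refine hlt (ENNReal.div_le_of_le_mul ?_)
    have hle' : (m : ℝ≥0∞) * p ≤ (m + 1) * v.length := by exact_mod_cast hle
    calc (p : ℝ≥0∞) = (m : ℝ≥0∞)⁻¹ * (m * p) := by
          rw [← mul_assoc, ENNReal.inv_mul_cancel (by simpa using hm0) (by simp), one_mul]
      _ ≤ (m : ℝ≥0∞)⁻¹ * ((m + 1) * v.length) := by gcongr
      _ = (1 + (m : ℝ≥0∞)⁻¹) * v.length := by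
          rw [← mul_assoc, mul_add, ENNReal.inv_mul_cancel (by simpa using hm0) (by simp), mul_one]
  have hvp : v.length < p := by
    by_contra! hle
    nlinarith
  obtain ⟨L, rfl⟩ := Nat.exists_eq_add_of_lt hvp
  refine hN i v.length (L + 1) hv0 ?_ (by nlinarith) fun t ht => ?_
  · by_contra! hL
    nlinarith
  · have hget : ∀ q < v.length + L + 1, g (i + q) = omegaPow v hv q := by
      intro q hq
      have := congrArg (·[q]?) (hu.symm.trans hp)
      simpa [pref, fracPow, hq] using this
    rw [hget t (by omega), add_assoc, hget (v.length + t) (by omega)]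
    simp [omegaPow]

theorem exists_injective_morphism (Γ : Type*) [Nontrivial Γ] :
    ∃ h : FreeMonoid (Fin 2) →* FreeMonoid Γ, Function.Injective h := by
  obtain ⟨x, y, hxy⟩ := exists_pair_ne Γ
  have hf : Function.Injective ![x, y] := by
    intro a b hab
    fin_cases a <;> fin_cases b <;> simp_all [eq_comm]
  exact ⟨FreeMonoid.map ![x, y], fun a b hab => List.map_injective_iff.2 hf hab⟩

/-- The image of `w` under a morphism has asymptotic critical exponent at most `1` if `w` avoids,
from some length on, periodic continuations with respect to a copy of the morphism over another
alphabet, obtained by renaming letters with `f`. The periods of interest are linear in the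
length `k` of the continuation, hence eventually below `k ^ 2`. -/
theorem ACE_image_le_one {Γ β : Type*} {f : Γ → β}
    {h : FreeMonoid (Fin 2) →* FreeMonoid Γ} (hh : Function.Injective h) {w : ℕ → Fin 2} {K : ℕ}
    (hw : ∀ s k p, K ≤ k → p ≤ k ^ 2 →
      ¬ Continues (fun a => (h (FreeMonoid.of a)).toList.map f) p (pref w s)
        ((pref w (s + k)).drop s)) : ACE (image h hh w) ≤ 1 := by
  set φ : Fin 2 → List β := fun a => (h (FreeMonoid.of a)).toList.map f
  have hφ : ∀ a, φ a ≠ [] := by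
    intro a ha
    have := length_le_of_injective h hh [a]
    rw [List.map_eq_nil_iff] at ha
    rw [FreeMonoid.ofList_singleton, ha] at this
    simp at this
  set M := (φ 0).length + (φ 1).length
  have hM : ∀ a, (φ a).length ≤ M := by
    intro a
    fin_cases a
    · exact Nat.le_add_right _ _
    · exact Nat.le_add_left _ _
  have hM0 : 0 < M := Nat.add_pos_left (List.length_pos_of_ne_nil (hφ 0)) _
  -- The term `5 m M` makes `p < m (k + 4) M ≤ 5 m M k` at most `k ^ 2`.
  refine ACE_le_one fun m => ⟨(K + 5 * m * M + 3) * M, fun i p L hp hL hpL hrep => ?_⟩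
  -- The repeated part has length `L` between `(k + 3) M` and `(k + 4) M`.
  obtain ⟨k, hk⟩ : ∃ k, L / M = k + 3 := by
    have : K + 5 * m * M + 3 ≤ L / M := (Nat.le_div_iff_mul_le hM0).2 hL
    exact ⟨L / M - 3, by omega⟩
  have hkK : K + 5 * m * M ≤ k := by
    have : K + 5 * m * M + 3 ≤ L / M := (Nat.le_div_iff_mul_le hM0).2 hL
    omega
  have hk3 : (k + 3) * M ≤ L := hk ▸ Nat.div_mul_le_self L M
  have hk4 : L < (k + 4) * M := by
    rw [← Nat.div_lt_iff_lt_mul hM0, hk]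
    omega
  obtain ⟨s, hs⟩ := exists_continues_of_repetition (g := fun q => f (image h hh w q)) hφ hM
    (fun n q hq => getElem?_flatMap_pref h hh f w hq) hp hk3 fun t ht => congrArg f (hrep t ht)
  refine hw s k p (by omega) ?_ hs
  have hm0 : 0 < m := by
    by_contra! h0
    obtain rfl : m = 0 := by omega
    omega
  have hk1 : 1 ≤ k := by
    have : 0 < 5 * m * M := by positivity
    omega
  calc p ≤ m * L := hpL.le
    _ ≤ m * ((k + 4) * M) := by gcongr
    _ ≤ m * ((5 * k) * M) := by
        gcongr
        omega
    _ = (5 * m * M) * k := by ring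
    _ ≤ k * k := by
        gcongr
        omega
    _ = k ^ 2 := (sq k).symm

end Words

theorem mainTheorem10 :
    ∃ w : ℕ → Fin 2, ∀ (Γ : Type*) [Finite Γ] [Nontrivial Γ], Words.mappedACE Γ w = 1 := by
  -- Over a countable alphabet there are only countably many morphisms.
  obtain ⟨φ, hφ⟩ := exists_surjective_nat (Fin 2 → List ℕ)
  obtain ⟨w, K, hw⟩ := Words.exists_forall_not_continues φ
  refine ⟨w, fun Γ _ _ => le_antisymm (iSup₂_le fun h hh => ?_) ?_⟩
  · obtain ⟨f, hf⟩ := Countable.exists_injective_nat Γ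
    obtain ⟨j, hj⟩ := hφ fun a => (h (FreeMonoid.of a)).toList.map f
    refine Words.ACE_image_le_one (f := f) hh (K := K + j + 1) fun s k p hk hp => ?_
    rw [← hj]
    refine hw s k j p (by omega) (by omega) hp ?_
    rw [hj]
    intro hc
    rw [← List.map_append, ← List.map_append, ← FreeMonoid.toList_mul, ← FreeMonoid.toList_mul,
      ← map_mul, ← map_mul] at hc
    have := hh (FreeMonoid.toList.injective (List.map_injective_iff.2 hf hc))
    have := congrArg FreeMonoid.toList this
    simp at this
  · obtain ⟨h, hh⟩ := Words.exists_injective_morphism Γ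
    exact (Words.one_le_ACE _).trans (le_iSup₂_of_le h hh le_rfl)
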